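/- Let $X$ be a Polish space with its Borel $\sigma$-algebra, $Y$ a real separable Hilbert space, and $T\colon X\to Y$ an admissible map, i.e. $T$ is Borel measurable, continuous and injective. Then the squared-exponential $T$ kernel $$k_T(x,y)=\exp\left(-\tfrac12\|T(x)-T(y)\|_Y^2\right),\qquad x,y\in X,$$ is characteristic. That is: $k_T$ is a measurable, symmetric, positive definite kernel on $X$ (all matrices $(k_T(x_i,x_j))_{i,j=1}^N$ are positive semi-definite); every Borel probability measure $P$ on $X$ satisfies $\int_X k_T(x,x)^{1/2}\,dP(x)<\infty$ and has a mean embedding $\Phi_{k_T}P=\int_X k_T(\cdot,x)\,dP(x)$, a Bochner integral in the reproducing kernel Hilbert space $\mathcal H_{k_T}(X)$ of $k_T$; and the map $P\mapsto \Phi_{k_T}P$ is injective on the set of all Borel probability measures on $X$. -/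

import Mathlib

open MeasureTheory

noncomputable section

namespace KernelMMD

universe u v

/-- A (real) kernel on `X`: a symmetric function all of whose finite Gram matrices are positive
semi-definite. -/
structure IsKernel {X : Type u} (k : X → X → ℝ) : Prop where
  symm : ∀ x y, k x y = k y x
  posSemidef : ∀ (N : ℕ) (x : Fin N → X),
    (Matrix.of fun i j : Fin N => k (x i) (x j)).PosSemidef

/-- A real kernel as an operator-valued matrix: the entry `k x y` acts on `ℝ` by multiplication. -/
def opMatrix {X : Type u} (k : X → X → ℝ) : Matrix X X (ℝ →L[ℝ] ℝ) :=
  Matrix.of fun x y => k x y • ContinuousLinearMap.id ℝ ℝ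

theorem IsKernel.sum_nonneg {X : Type u} {k : X → X → ℝ} (hk : IsKernel k) (s : Finset X)
    (c : X → ℝ) : 0 ≤ ∑ x ∈ s, ∑ y ∈ s, c x * k x y * c y := by
  have h := (hk.posSemidef s.card fun i => (s.equivFin.symm i : X)).dotProduct_mulVec_nonneg
    fun i => c (s.equivFin.symm i)
  have e : ∀ f : X → ℝ, ∑ x ∈ s, f x = ∑ i : Fin s.card, f (s.equivFin.symm i) := fun f => by
    rw [← Finset.sum_coe_sort s f]
    exact (Equiv.sum_comp s.equivFin.symm (fun x : s => f x)).symm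
  simp only [e]
  simpa [dotProduct, Matrix.mulVec, Finset.mul_sum, mul_assoc] using h

theorem IsKernel.posSemidef_opMatrix {X : Type u} {k : X → X → ℝ} (hk : IsKernel k) :
    (opMatrix k).PosSemidef := by
  have hH : (opMatrix k).IsHermitian := by
    ext x y
    have h1 : star (ContinuousLinearMap.id ℝ ℝ) = ContinuousLinearMap.id ℝ ℝ :=
      star_one (ℝ →L[ℝ] ℝ)
    simp [opMatrix, hk.symm x y, h1]
  have ht := (RKHS.posSemidef_tfae (K := opMatrix k)).out 2 0
  refine ht.mp ⟨hH, fun c => ?_⟩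
  have h := hk.sum_nonneg c.support c
  refine h.trans_eq ?_
  simp only [Finsupp.sum, opMatrix, Matrix.of_apply, RCLike.re_to_real]
  refine Finset.sum_congr rfl fun x _ => Finset.sum_congr rfl fun y _ => ?_
  simp [hk.symm x y]
  ring

/-- The reproducing kernel Hilbert space `H_k` of a real kernel `k`: the completion of the span of
the functions `k(·, x)` for the inner product with `⟪k(·, x), k(·, y)⟫ = k x y`, realised as a
space of functions on `X`. -/
def KernelRKHS {X : Type u} (k : X → X → ℝ) (hk : IsKernel k) : Type u :=
  haveI : Fact (opMatrix k).PosSemidef := ⟨hk.posSemidef_opMatrix⟩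
  RKHS.OfKernel (opMatrix k)

instance instNormedAddCommGroup {X : Type u} (k : X → X → ℝ) (hk : IsKernel k) :
    NormedAddCommGroup (KernelRKHS k hk) :=
  haveI : Fact (opMatrix k).PosSemidef := ⟨hk.posSemidef_opMatrix⟩
  inferInstanceAs (NormedAddCommGroup (RKHS.OfKernel (opMatrix k)))

instance instInnerProductSpace {X : Type u} (k : X → X → ℝ) (hk : IsKernel k) :
    InnerProductSpace ℝ (KernelRKHS k hk) :=
  haveI : Fact (opMatrix k).PosSemidef := ⟨hk.posSemidef_opMatrix⟩
  inferInstanceAs (InnerProductSpace ℝ (RKHS.OfKernel (opMatrix k)))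

instance instCompleteSpace {X : Type u} (k : X → X → ℝ) (hk : IsKernel k) :
    CompleteSpace (KernelRKHS k hk) :=
  haveI : Fact (opMatrix k).PosSemidef := ⟨hk.posSemidef_opMatrix⟩
  inferInstanceAs (CompleteSpace (RKHS.OfKernel (opMatrix k)))

instance instRKHS {X : Type u} (k : X → X → ℝ) (hk : IsKernel k) :
    RKHS ℝ (KernelRKHS k hk) X ℝ :=
  haveI : Fact (opMatrix k).PosSemidef := ⟨hk.posSemidef_opMatrix⟩
  inferInstanceAs (RKHS ℝ (RKHS.OfKernel (opMatrix k)) X ℝ)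

theorem kernel_kernelRKHS {X : Type u} (k : X → X → ℝ) (hk : IsKernel k) :
    RKHS.kernel (KernelRKHS k hk) = opMatrix k :=
  haveI : Fact (opMatrix k).PosSemidef := ⟨hk.posSemidef_opMatrix⟩
  RKHS.OfKernel.kernel_ofKernel (K := opMatrix k)

/-- The function `k(·, x)` as an element of `H_k`. -/
def feature {X : Type u} (k : X → X → ℝ) (hk : IsKernel k) (x : X) : KernelRKHS k hk :=
  RKHS.kerFun (KernelRKHS k hk) x 1

theorem feature_apply {X : Type u} (k : X → X → ℝ) (hk : IsKernel k) (x y : X) :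
    feature k hk x y = k y x := by
  rw [feature, RKHS.kerFun_apply, kernel_kernelRKHS]
  simp [opMatrix]

/-- The reproducing property. -/
theorem inner_feature {X : Type u} (k : X → X → ℝ) (hk : IsKernel k) (f : KernelRKHS k hk)
    (x : X) : inner ℝ f (feature k hk x) = f x := by
  simp [feature]

/-- `P_k`: the Borel probability measures `P` with `∫ k(x, x)^{1/2} dP(x) < ∞`. -/
def embeddable {X : Type u} [MeasurableSpace X] (k : X → X → ℝ) : Set (ProbabilityMeasure X) :=
  {P | Integrable (fun x => Real.sqrt (k x x)) (P : Measure X)}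

/-- The mean embedding `Φ_k P = ∫ k(·, x) dP(x)`, a Bochner integral in `H_k`. -/
def meanEmbedding {X : Type u} [MeasurableSpace X] (k : X → X → ℝ) (hk : IsKernel k)
    (P : ProbabilityMeasure X) : KernelRKHS k hk :=
  ∫ x, feature k hk x ∂(P : Measure X)

/-- The kernel `k` is characteristic to a set `S ⊆ P_k` of probability measures: the mean embedding
is well defined (the Bochner integrals exist) and injective on `S`. -/
structure IsCharacteristicTo {X : Type u} [MeasurableSpace X] (k : X → X → ℝ) (hk : IsKernel k)
    (S : Set (ProbabilityMeasure X)) : Prop where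
  measurable : Measurable (Function.uncurry k)
  subset : S ⊆ embeddable k
  integrable : ∀ P ∈ S, Integrable (feature k hk) (P : Measure X)
  injOn : Set.InjOn (meanEmbedding k hk) S

/-- `k` is a characteristic kernel: it is a kernel, and it is characteristic to the set of all
probability measures on `X`. -/
def IsCharacteristic {X : Type u} [MeasurableSpace X] (k : X → X → ℝ) : Prop :=
  ∃ hk : IsKernel k, IsCharacteristicTo k hk Set.univ

/-- The squared-exponential `T` kernel. -/
def seKernel {X : Type u} {Y : Type v} [NormedAddCommGroup Y] (T : X → Y) (x y : X) : ℝ :=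
  Real.exp (-(1 / 2 : ℝ) * ‖T x - T y‖ ^ 2)

/-- Admissible maps. -/
structure IsAdmissible {X : Type u} {Y : Type v} [TopologicalSpace X] [MeasurableSpace X]
    [TopologicalSpace Y] [MeasurableSpace Y] (T : X → Y) : Prop where
  measurable : Measurable T
  continuous : Continuous T
  injective : Function.Injective T

end KernelMMD

end

/-!
For Borel probability measures `P` and `Q` on `X`, write `μ = T_* P` and `ν = T_* Q`.
The proof has two steps.

*From the range of `T` to the whole of `Y`.* Equality of the mean embeddings of `P` and `Q` only
says that `∫ exp (-‖x - y‖² / 2) dμ(x) = ∫ exp (-‖x - y‖² / 2) dν(x)` for `y` in the range of `T`.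
In the reproducing kernel Hilbert space of the Gaussian kernel on all of `Y`, it says that the
difference of the mean embeddings of `μ` and `ν` is orthogonal to the features of all points of the
range of `T`. That difference is itself an integral of such features, so it is orthogonal to itself,
hence zero, and the equality of integrals holds for every `y : Y`
(`integral_eq_of_meanEmbedding_eq`).

*Gaussian transforms determine measures on `Y`.* Since
`exp (-‖x - y‖² / 2) = exp (-‖x‖² / 2) * exp ⟪x, y⟫ * exp (-‖y‖² / 2)`, the probability measures
with densities proportional to `exp (-‖x‖² / 2)` with respect to `μ` and `ν` have the same finite
moment generating function along every direction. By analytic continuation their characteristic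
functions agree, so they are equal, and dividing by the density gives `μ = ν`
(`ext_of_integral_exp_neg_norm_sub_sq`). Finally `T` is a measurable embedding, by the Lusin–Souslin
theorem, so `P = Q`.

Positive definiteness comes from the same factorisation, the exponential series and Schur's product
theorem (`isKernel_seKernel`).
-/

open MeasureTheory ProbabilityTheory

namespace KernelMMD

theorem posSemidef_inner_pow {Y ι : Type*} [NormedAddCommGroup Y] [InnerProductSpace ℝ Y]
    [Finite ι] (x : ι → Y) (n : ℕ) :
    (Matrix.of fun i j => (inner ℝ (x i) (x j)) ^ n : Matrix ι ι ℝ).PosSemidef := by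
  induction n with
  | zero =>
    have e : (Matrix.of fun i j => (inner ℝ (x i) (x j)) ^ 0 : Matrix ι ι ℝ) =
        Matrix.gram ℝ fun _ : ι => (1 : ℝ) := by
      ext i j
      simp [Matrix.gram]
    exact e ▸ Matrix.posSemidef_gram ℝ _
  | succ n ih =>
    exact ih.hadamard (Matrix.posSemidef_gram ℝ x)

theorem sum_exp_inner_nonneg {Y ι : Type*} [NormedAddCommGroup Y] [InnerProductSpace ℝ Y]
    [Fintype ι] (x : ι → Y) (c : ι → ℝ) :
    0 ≤ ∑ i, ∑ j, c i * Real.exp (inner ℝ (x i) (x j)) * c j := by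
  have hs : HasSum (fun n : ℕ => ∑ i, ∑ j, c i * ((inner ℝ (x i) (x j)) ^ n / n.factorial) * c j)
      (∑ i, ∑ j, c i * Real.exp (inner ℝ (x i) (x j)) * c j) := by
    refine hasSum_sum fun i _ => hasSum_sum fun j _ => ?_
    rw [Real.exp_eq_exp_ℝ]
    exact ((NormedSpace.expSeries_div_hasSum_exp (inner ℝ (x i) (x j))).mul_left _).mul_right _
  refine hs.nonneg fun n => ?_
  have h := (posSemidef_inner_pow x n).dotProduct_mulVec_nonneg c
  refine (div_nonneg h (Nat.cast_nonneg n.factorial)).trans_eq ?_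
  simp only [dotProduct, Matrix.mulVec, Finset.mul_sum, Finset.sum_div, Matrix.of_apply,
    Pi.star_apply, star_trivial]
  refine Finset.sum_congr rfl fun i _ => Finset.sum_congr rfl fun j _ => ?_
  ring

theorem exp_neg_norm_sub_sq {Y : Type*} [NormedAddCommGroup Y] [InnerProductSpace ℝ Y] (x y : Y) :
    Real.exp (-(1 / 2 : ℝ) * ‖x - y‖ ^ 2) =
      Real.exp (-(1 / 2 : ℝ) * ‖x‖ ^ 2) * Real.exp (inner ℝ x y) *
        Real.exp (-(1 / 2 : ℝ) * ‖y‖ ^ 2) := by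
  rw [← Real.exp_add, ← Real.exp_add, norm_sub_sq_real]
  ring_nf

theorem isKernel_seKernel {X Y : Type*} [NormedAddCommGroup Y] [InnerProductSpace ℝ Y]
    (T : X → Y) : IsKernel (seKernel T) where
  symm x y := by rw [seKernel, seKernel, norm_sub_rev]
  posSemidef N x := by
    refine .of_dotProduct_mulVec_nonneg ?_ fun c => ?_
    · ext i j
      simp [seKernel, norm_sub_rev]
    · refine (sum_exp_inner_nonneg (fun i => T (x i))
        (fun i => c i * Real.exp (-(1 / 2 : ℝ) * ‖T (x i)‖ ^ 2))).trans_eq ?_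
      simp only [dotProduct, Matrix.mulVec, Finset.mul_sum, Matrix.of_apply, Pi.star_apply,
        star_trivial, seKernel, exp_neg_norm_sub_sq]
      refine Finset.sum_congr rfl fun i _ => Finset.sum_congr rfl fun j _ => ?_
      ring

/-! ### Feature maps -/

theorem inner_feature_feature {X : Type*} {k : X → X → ℝ} (hk : IsKernel k) (x y : X) :
    inner ℝ (feature k hk x) (feature k hk y) = k x y := by
  rw [inner_feature, feature_apply, hk.symm]

theorem continuous_feature {X : Type*} [TopologicalSpace X] {k : X → X → ℝ} (hk : IsKernel k)
    (hc : Continuous (Function.uncurry k)) : Continuous (feature k hk) := by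
  rw [continuous_iff_continuousAt]
  intro x
  have hk2 {f g : X → X} (hf : Continuous f) (hg : Continuous g) :
      Continuous fun y => k (f y) (g y) := hc.comp (hf.prodMk hg)
  have hsq : Continuous fun y => √(k y y - 2 * k y x + k x x) :=
    (((hk2 continuous_id continuous_id).sub
      ((hk2 continuous_id continuous_const).const_mul 2)).add continuous_const).sqrt
  have hn (y : X) : ‖feature k hk y - feature k hk x‖ = √(k y y - 2 * k y x + k x x) := by
    rw [← Real.sqrt_sq (norm_nonneg (feature k hk y - feature k hk x)), norm_sub_sq_real,
      ← real_inner_self_eq_norm_sq, ← real_inner_self_eq_norm_sq, inner_feature_feature,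
      inner_feature_feature, inner_feature_feature]
  rw [ContinuousAt, tendsto_iff_norm_sub_tendsto_zero]
  simp only [hn]
  have h0 : √(k x x - 2 * k x x + k x x) = 0 := by
    rw [show k x x - 2 * k x x + k x x = 0 by ring, Real.sqrt_zero]
  exact h0 ▸ hsq.tendsto x

theorem seKernel_self {X Y : Type*} [NormedAddCommGroup Y] (T : X → Y) (x : X) :
    seKernel T x x = 1 := by
  simp [seKernel]

theorem continuous_uncurry_seKernel {X Y : Type*} [TopologicalSpace X] [NormedAddCommGroup Y]
    {T : X → Y} (hT : Continuous T) : Continuous (Function.uncurry (seKernel T)) := by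
  unfold seKernel Function.uncurry
  fun_prop

theorem integrable_feature_seKernel {X Y : Type*} [TopologicalSpace X] [SecondCountableTopology X]
    [MeasurableSpace X] [OpensMeasurableSpace X] [NormedAddCommGroup Y] [InnerProductSpace ℝ Y]
    {T : X → Y} (hT : Continuous T) (P : Measure X) [IsFiniteMeasure P] :
    Integrable (feature (seKernel T) (isKernel_seKernel T)) P := by
  refine .of_bound (continuous_feature _
    (continuous_uncurry_seKernel hT)).aestronglyMeasurable 1 (.of_forall fun x => ?_)
  rw [← sq_le_one_iff₀ (norm_nonneg _), ← real_inner_self_eq_norm_sq, inner_feature_feature,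
    seKernel_self]

theorem meanEmbedding_apply {X : Type*} [MeasurableSpace X] {k : X → X → ℝ} (hk : IsKernel k)
    (P : ProbabilityMeasure X) (hP : Integrable (feature k hk) (P : Measure X)) (y : X) :
    meanEmbedding k hk P y = ∫ x, k y x ∂(P : Measure X) := by
  rw [← inner_feature, real_inner_comm, meanEmbedding, ← integral_inner hP]
  simp only [inner_feature_feature]

/-! ### Extension to the whole Hilbert space -/

/-- The difference of the embeddings into the space of the kernel on `Y` is orthogonal to the
features of the range of `T`, and lies in their closed span, so it vanishes. -/
theorem integral_eq_of_meanEmbedding_eq {X Y : Type*} [TopologicalSpace X]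
    [SecondCountableTopology X] [MeasurableSpace X] [OpensMeasurableSpace X]
    [NormedAddCommGroup Y] [InnerProductSpace ℝ Y] {T : X → Y} (hT : Continuous T)
    {P Q : ProbabilityMeasure X}
    (h : meanEmbedding (seKernel T) (isKernel_seKernel T) P =
      meanEmbedding (seKernel T) (isKernel_seKernel T) Q) (y : Y) :
    ∫ x, Real.exp (-(1 / 2 : ℝ) * ‖T x - y‖ ^ 2) ∂(P : Measure X) =
      ∫ x, Real.exp (-(1 / 2 : ℝ) * ‖T x - y‖ ^ 2) ∂(Q : Measure X) := by
  set φ := feature (seKernel (id : Y → Y)) (isKernel_seKernel id) with hφ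
  have hint (R : ProbabilityMeasure X) : Integrable (fun x => φ (T x)) (R : Measure X) := by
    refine .of_bound ((continuous_feature _ (continuous_uncurry_seKernel continuous_id)).comp
      hT).aestronglyMeasurable 1 (.of_forall fun x => ?_)
    rw [← sq_le_one_iff₀ (norm_nonneg _), ← real_inner_self_eq_norm_sq, inner_feature_feature,
      seKernel_self]
  have hφy (R : ProbabilityMeasure X) (y : Y) : inner ℝ (φ y) (∫ x, φ (T x) ∂(R : Measure X)) =
      ∫ x, Real.exp (-(1 / 2 : ℝ) * ‖T x - y‖ ^ 2) ∂(R : Measure X) := by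
    rw [← integral_inner (hint R)]
    refine integral_congr_ae (.of_forall fun x => ?_)
    simp only [hφ, inner_feature_feature, seKernel, id, norm_sub_rev y]
  set d := (∫ x, φ (T x) ∂(P : Measure X)) - ∫ x, φ (T x) ∂(Q : Measure X) with hd
  have horth (z : X) : inner ℝ d (φ (T z)) = 0 := by
    have hz := congrArg (fun f : KernelRKHS _ (isKernel_seKernel T) => f z) h
    simp only [meanEmbedding_apply _ _ (integrable_feature_seKernel hT _), seKernel,
      norm_sub_rev (T z)] at hz
    rw [real_inner_comm, hd, inner_sub_right, hφy, hφy, hz, sub_self]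
  have hd0 : d = 0 := by
    rw [← inner_self_eq_zero (𝕜 := ℝ)]
    nth_rewrite 2 [hd]
    rw [inner_sub_right, ← integral_inner (hint P), ← integral_inner (hint Q)]
    simp [horth]
  rw [← hφy, ← hφy, sub_eq_zero.mp hd0]

/-! ### Gaussian transforms determine measures -/

/-- Two probability measures on a separable Hilbert space with the same integrals of all Gaussian
functions of a fixed width are equal. -/
theorem ext_of_integral_exp_neg_norm_sub_sq {Y : Type*} [NormedAddCommGroup Y]
    [InnerProductSpace ℝ Y] [CompleteSpace Y] [SecondCountableTopology Y] [MeasurableSpace Y]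
    [BorelSpace Y] {μ ν : Measure Y} [IsProbabilityMeasure μ] [IsProbabilityMeasure ν]
    (h : ∀ y, ∫ x, Real.exp (-(1 / 2 : ℝ) * ‖x - y‖ ^ 2) ∂μ =
      ∫ x, Real.exp (-(1 / 2 : ℝ) * ‖x - y‖ ^ 2) ∂ν) : μ = ν := by
  set f : Y → ℝ := fun x => -(1 / 2 : ℝ) * ‖x‖ ^ 2 with hf
  have hadd (y : Y) (t : ℝ) : (fun x => Real.exp ((f + fun x => t * inner ℝ x y) x)) =
      fun x => Real.exp (-(1 / 2 : ℝ) * ‖x - t • y‖ ^ 2) *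
        Real.exp ((1 / 2 : ℝ) * ‖t • y‖ ^ 2) := by
    ext x
    rw [exp_neg_norm_sub_sq, ← Real.exp_add, ← Real.exp_add, ← Real.exp_add, real_inner_smul_right]
    simp only [hf, Pi.add_apply]
    ring_nf
  have hbd (m : Measure Y) [IsProbabilityMeasure m] (y : Y) :
      Integrable (fun x => Real.exp (-(1 / 2 : ℝ) * ‖x - y‖ ^ 2)) m := by
    refine .of_bound (by fun_prop) 1 (.of_forall fun x => ?_)
    rw [Real.norm_of_nonneg (Real.exp_pos _).le, Real.exp_le_one_iff]
    nlinarith [sq_nonneg ‖x - y‖]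
  have hfi (m : Measure Y) [IsProbabilityMeasure m] : Integrable (fun x => Real.exp (f x)) m := by
    simpa [hf] using hbd m 0
  have := isProbabilityMeasure_tilted (hfi μ)
  have := isProbabilityMeasure_tilted (hfi ν)
  suffices htilt : μ.tilted f = ν.tilted f by
    rw [← tilted_neg_same (hfi μ), ← tilted_neg_same (hfi ν), htilt]
  refine Measure.ext_of_charFun (funext fun y => ?_)
  have hmgf : mgf (fun x => inner ℝ x y) (μ.tilted f) =
      mgf (fun x => inner ℝ x y) (ν.tilted f) := by
    ext t
    have h0 : ∫ x, Real.exp (f x) ∂μ = ∫ x, Real.exp (f x) ∂ν := by simpa [hf] using h 0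
    rw [mgf, mgf, integral_exp_tilted, integral_exp_tilted, hadd, integral_mul_const,
      integral_mul_const, h, h0]
  have huniv : integrableExpSet (fun x => inner ℝ x y) (μ.tilted f) = Set.univ := by
    refine Set.eq_univ_of_forall fun t => ?_
    rw [integrableExpSet, Set.mem_ofPred_eq, integrable_tilted_iff (hfi μ)]
    refine ((hbd μ (t • y)).mul_const (Real.exp ((1 / 2 : ℝ) * ‖t • y‖ ^ 2))).congr
      (.of_forall fun x => ?_)
    refine (congrFun (hadd y t) x).symm.trans ?_
    simp only [Pi.add_apply, Real.exp_add, smul_eq_mul]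
  -- The characteristic function at `y` is the complex moment generating function at `I`.
  have hI := eqOn_complexMGF_of_mgf hmgf (x := Complex.I) (by simp [huniv])
  simpa only [complexMGF, charFun_apply, mul_comm Complex.I] using hI

end KernelMMD

theorem theorem4p3 {X : Type*} [TopologicalSpace X] [PolishSpace X] [MeasurableSpace X]
    [BorelSpace X] {Y : Type*} [NormedAddCommGroup Y] [InnerProductSpace ℝ Y] [CompleteSpace Y]
    [TopologicalSpace.SeparableSpace Y] [MeasurableSpace Y] [BorelSpace Y]
    (T : X → Y) (hT : KernelMMD.IsAdmissible T) :
    KernelMMD.IsCharacteristic (KernelMMD.seKernel T) := by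
  have : SecondCountableTopology Y := UniformSpace.secondCountable_of_separable Y
  refine ⟨KernelMMD.isKernel_seKernel T,
    (KernelMMD.continuous_uncurry_seKernel hT.continuous).measurable, fun P _ => ?_,
    fun P _ => KernelMMD.integrable_feature_seKernel hT.continuous _, fun P _ Q _ hPQ => ?_⟩
  · simp [KernelMMD.embeddable, KernelMMD.seKernel_self]
  · -- A continuous injection between Polish spaces is a measurable embedding.
    have hemb := hT.continuous.measurableEmbedding hT.injective
    refine Subtype.ext (hemb.map_injective ?_)
    change (P : Measure X).map T = (Q : Measure X).map T
    have : IsProbabilityMeasure ((P : Measure X).map T) :=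
      Measure.isProbabilityMeasure_map hT.measurable.aemeasurable
    have : IsProbabilityMeasure ((Q : Measure X).map T) :=
      Measure.isProbabilityMeasure_map hT.measurable.aemeasurable
    refine KernelMMD.ext_of_integral_exp_neg_norm_sub_sq fun y => ?_
    rw [hemb.integral_map, hemb.integral_map]
    exact KernelMMD.integral_eq_of_meanEmbedding_eq hT.continuous hPQ y
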